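/- Let $\mathrm{Cu}_2=\langle a_1,a_2,b_1,b_2 : a_1b_1=e=a_2b_2,\ a_1b_2=\lozenge=a_2b_1\rangle$ be the second Cuntz semigroup, i.e. the monoid with identity $e$ and zero element $\lozenge$ given by this presentation. For $n\in\mathbb N=\{1,2,\dots\}$ let $\omega_n$ be the weight on $\mathrm{Cu}_2$ with $\omega_n(e)=\omega_n(\lozenge)=1$ and $\omega_n(s)=n$ for $s\neq e,\lozenge$, and let $\mu_n$ be its restriction to $\mathrm{Cu}_2\setminus\{\lozenge\}$. Let $\mathcal A_n=(\ell^1(\mathrm{Cu}_2\setminus\{\lozenge\},\mu_n),\#)$ be the unital complex Banach algebra of all $f:\mathrm{Cu}_2\setminus\{\lozenge\}\to\mathbb C$ with $\|f\|=\sum_s|f(s)|\mu_n(s)<\infty$, where $\#$ is the product induced by the convolution of $\ell^1(\mathrm{Cu}_2,\omega_n)$ through the isometric identification with $\ell^1(\mathrm{Cu}_2,\omega_n)/\mathbb C\delta_\lozenge$ that restriction of functions gives; thus $\delta_s\#\delta_t=\delta_{st}$ if $st\neq\lozenge$ and $\delta_s\#\delta_t=0$ otherwise. For a sequence $(\mathcal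 B_n)$ of unital Banach algebras (with contractive product and $\|1\|=1$) let $\mathrm{Asy}(\mathcal B_n)=\ell^\infty(\mathcal B_n)/c_0(\mathcal B_n)$, where $\ell^\infty(\mathcal B_n)$ is the algebra of bounded sequences $(x_n)$, $x_n\in\mathcal B_n$, with pointwise operations, and $c_0(\mathcal B_n)$ its ideal of sequences with $\|x_n\|\to0$. A unital algebra $\mathcal B$ is properly infinite if there are idempotents $p,q\in\mathcal B$ with $pq=0=qp$ and $p\sim1$, $q\sim1$, where $p\sim q$ means that $p=xy$ and $q=yx$ for some $x,y\in\mathcal B$. Then every $\mathcal A_n$ is properly infinite, but $\mathrm{Asy}(\mathcal A_n)$ is not properly infinite. Consequently it is not true that, for every sequence $(\mathcal B_n)$ of unital complex Banach algebras for which there is $N$ such that $\mathcal B_n$ is properly infinite for all $n\ge N$, the algebra $\mathrm{Asy}(\mathcal B_n)$ is properly infinite. -/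

import Mathlib

open Filter
open scoped ENNReal Topology

noncomputable section

/-! ### Weighted `ℓ¹`-spaces -/

/-- The functions `f : I → ℂ` with `∑ |f s| ν s < ∞`, where `ν : I → (0, ∞)`. -/
def l1Submodule {I : Type*} (ν : I → Set.Ioi (0 : ℝ)) : Submodule ℂ (I → ℂ) where
  carrier := {f | Summable fun s => ‖f s‖ * (ν s : ℝ)}
  zero_mem' := by simp [summable_zero]
  add_mem' := by
    intro f g hf hg
    refine Summable.of_nonneg_of_le
      (fun s => mul_nonneg (norm_nonneg _) (ν s).2.le) (fun s => ?_) (hf.add hg)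
    rw [← add_mul]
    exact mul_le_mul_of_nonneg_right (norm_add_le _ _) (ν s).2.le
  smul_mem' := by
    intro c f hf
    have h := hf.mul_left ‖c‖
    refine h.congr (fun s => ?_)
    simp [mul_assoc]

/-- The weighted space `ℓ¹(I, ν)`. -/
def WeightedL1 {I : Type*} (ν : I → Set.Ioi (0 : ℝ)) : Type _ := l1Submodule ν

namespace WeightedL1

variable {I : Type*} {ν : I → Set.Ioi (0 : ℝ)}

instance instAddCommGroup : AddCommGroup (WeightedL1 ν) :=
  inferInstanceAs (AddCommGroup (l1Submodule ν))

instance instModule : Module ℂ (WeightedL1 ν) :=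
  inferInstanceAs (Module ℂ (l1Submodule ν))

instance instFunLike : FunLike (WeightedL1 ν) I ℂ := ⟨fun f => f.1, Subtype.val_injective⟩

/-- Constructor from a function of finite weighted norm. -/
def mk (f : I → ℂ) (hf : Summable fun s => ‖f s‖ * (ν s : ℝ)) : WeightedL1 ν := ⟨f, hf⟩

@[simp] theorem mk_apply (f : I → ℂ) (hf : Summable fun s => ‖f s‖ * (ν s : ℝ)) (s : I) :
    (mk f hf : WeightedL1 ν) s = f s := rfl

@[ext] theorem ext {f g : WeightedL1 ν} (h : ∀ s, f s = g s) : f = g :=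
  Subtype.ext (funext h)

theorem summable (f : WeightedL1 ν) : Summable fun s => ‖f s‖ * (ν s : ℝ) := f.2

@[simp] theorem zero_apply (s : I) : (0 : WeightedL1 ν) s = 0 := rfl

@[simp] theorem add_apply (f g : WeightedL1 ν) (s : I) : (f + g) s = f s + g s := rfl

@[simp] theorem neg_apply (f : WeightedL1 ν) (s : I) : (-f) s = -f s := rfl

@[simp] theorem sub_apply (f g : WeightedL1 ν) (s : I) : (f - g) s = f s - g s := rfl

@[simp] theorem smul_apply (c : ℂ) (f : WeightedL1 ν) (s : I) : (c • f) s = c * f s := rfl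

/-- `‖f‖_ν = ∑ |f s| ν s`. -/
instance instNorm : Norm (WeightedL1 ν) := ⟨fun f => ∑' s, ‖f s‖ * (ν s : ℝ)⟩

theorem norm_def (f : WeightedL1 ν) : ‖f‖ = ∑' s, ‖f s‖ * (ν s : ℝ) := rfl

theorem term_nonneg (f : WeightedL1 ν) (s : I) : 0 ≤ ‖f s‖ * (ν s : ℝ) :=
  mul_nonneg (norm_nonneg _) (ν s).2.le

theorem core : NormedSpace.Core ℂ (WeightedL1 ν) where
  norm_nonneg f := tsum_nonneg f.term_nonneg
  norm_smul c f := by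
    simp only [norm_def, smul_apply, norm_mul, mul_assoc]
    exact tsum_mul_left
  norm_triangle f g := by
    simp only [norm_def]
    rw [← f.summable.tsum_add g.summable]
    refine (f + g).summable.tsum_le_tsum (fun s => ?_) (f.summable.add g.summable)
    rw [← add_mul]
    exact mul_le_mul_of_nonneg_right (norm_add_le _ _) (ν s).2.le
  norm_eq_zero_iff f := by
    refine ⟨fun h => ?_, fun h => by simp [norm_def, h]⟩
    ext s
    have h1 : HasSum (fun s => ‖f s‖ * (ν s : ℝ)) 0 := by
      have h2 := f.summable.hasSum
      rwa [show ∑' s, ‖f s‖ * (ν s : ℝ) = 0 from h] at h2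
    have h0 := (hasSum_zero_iff_of_nonneg f.term_nonneg).1 h1
    have hs := congrFun h0 s
    have hν : (ν s : ℝ) ≠ 0 := (ν s).2.ne'
    simpa [hν] using hs

instance instNormedAddCommGroup : NormedAddCommGroup (WeightedL1 ν) :=
  NormedAddCommGroup.ofCore core

instance instNormedSpace : NormedSpace ℂ (WeightedL1 ν) := NormedSpace.ofCore core

instance instCompleteSpace : CompleteSpace (WeightedL1 ν) := by
  have hmem : ∀ f : WeightedL1 ν, Memℓp (fun s => f s * (ν s : ℂ)) 1 := by
    intro f
    refine memℓp_gen ?_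
    refine f.summable.congr (fun s => ?_)
    have : |(ν s : ℝ)| = ν s := abs_of_pos (ν s).2
    simp [this]
  let T : WeightedL1 ν →+ lp (fun _ : I => ℂ) 1 :=
    { toFun := fun f => ⟨fun s => f s * (ν s : ℂ), hmem f⟩
      map_zero' := by ext s; simp
      map_add' := by
        intro f g
        ext s
        exact add_mul (f s) (g s) _ }
  have hT : Isometry T := by
    refine AddMonoidHomClass.isometry_of_norm T (fun f => ?_)
    rw [lp.norm_eq_tsum_rpow (by simp), norm_def]
    simp only [ENNReal.toReal_one, Real.rpow_one, div_one]
    refine tsum_congr (fun s => ?_)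
    have : |(ν s : ℝ)| = ν s := abs_of_pos (ν s).2
    simp [T, this]
  have hsurj : Function.Surjective T := by
    intro g
    have hν : ∀ s, ((ν s : ℝ) : ℂ) ≠ 0 := fun s => by exact_mod_cast (ν s).2.ne'
    have hg : Summable fun s => ‖g s‖ := by
      simpa using (lp.memℓp g).summable (by simp)
    refine ⟨mk (fun s => g s / (ν s : ℂ)) ?_, ?_⟩
    · refine hg.congr (fun s => ?_)
      have : |(ν s : ℝ)| = ν s := abs_of_pos (ν s).2
      have h' : (ν s : ℝ) ≠ 0 := (ν s).2.ne'
      simp [this, h']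
    · ext s
      simp [T, hν s]
  exact (hT.isUniformInducing.completeSpace_congr hsurj).2 inferInstance

end WeightedL1

/-! ### Weights and the convolution algebra `ℓ¹(S, ω)` -/

/-- A (normalised, submultiplicative) weight `ω : S → (0, ∞)` on a monoid. -/
structure Weight (S : Type*) [Monoid S] where
  /-- The underlying function. -/
  toFun : S → Set.Ioi (0 : ℝ)
  map_one : (toFun 1 : ℝ) = 1
  map_mul_le : ∀ s t, (toFun (s * t) : ℝ) ≤ toFun s * toFun t

section Convolution

variable {S : Type*} [Monoid S]

/-- The convolution `(f ∗ g)(r) = ∑_{st = r} f(s) g(t)`. -/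
def convFun (f g : S → ℂ) (r : S) : ℂ :=
  ∑' p : {p : S × S // p.1 * p.2 = r}, f p.1.1 * g p.1.2

variable {ω : Weight S}

theorem summable_prod (f g : WeightedL1 ω.toFun) :
    Summable fun p : S × S =>
      (‖f p.1‖ * (ω.toFun p.1 : ℝ)) * (‖g p.2‖ * (ω.toFun p.2 : ℝ)) :=
  f.summable.mul_of_nonneg g.summable f.term_nonneg g.term_nonneg

theorem conv_term_le (f g : WeightedL1 ω.toFun) (r : S) (p : {p : S × S // p.1 * p.2 = r}) :
    ‖f p.1.1 * g p.1.2‖ * (ω.toFun r : ℝ) ≤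
      (‖f p.1.1‖ * (ω.toFun p.1.1 : ℝ)) * (‖g p.1.2‖ * (ω.toFun p.1.2 : ℝ)) := by
  obtain ⟨⟨a, b⟩, rfl⟩ := p
  rw [norm_mul]
  calc ‖f a‖ * ‖g b‖ * (ω.toFun (a * b) : ℝ)
      ≤ ‖f a‖ * ‖g b‖ * ((ω.toFun a : ℝ) * ω.toFun b) :=
        mul_le_mul_of_nonneg_left (ω.map_mul_le a b) (by positivity)
    _ = _ := by ring

theorem conv_term_summable (f g : WeightedL1 ω.toFun) (r : S) :
    Summable fun p : {p : S × S // p.1 * p.2 = r} => ‖f p.1.1 * g p.1.2‖ := by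
  have h : Summable fun p : {p : S × S // p.1 * p.2 = r} =>
      ‖f p.1.1 * g p.1.2‖ * (ω.toFun r : ℝ) :=
    Summable.of_nonneg_of_le (fun p => mul_nonneg (norm_nonneg _) (ω.toFun r).2.le)
      (conv_term_le f g r) ((summable_prod f g).subtype _)
  exact (summable_mul_right_iff (ω.toFun r).2.ne').1 h

theorem conv_norm_le (f g : WeightedL1 ω.toFun) (r : S) :
    ‖convFun f g r‖ * (ω.toFun r : ℝ) ≤ ∑' p : {p : S × S // p.1 * p.2 = r},
      (‖f p.1.1‖ * (ω.toFun p.1.1 : ℝ)) * (‖g p.1.2‖ * (ω.toFun p.1.2 : ℝ)) := by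
  have h := conv_term_summable f g r
  calc ‖convFun f g r‖ * (ω.toFun r : ℝ)
      ≤ (∑' p : {p : S × S // p.1 * p.2 = r}, ‖f p.1.1 * g p.1.2‖) * (ω.toFun r : ℝ) :=
        mul_le_mul_of_nonneg_right (norm_tsum_le_tsum_norm h) (ω.toFun r).2.le
    _ = ∑' p : {p : S × S // p.1 * p.2 = r}, ‖f p.1.1 * g p.1.2‖ * (ω.toFun r : ℝ) :=
        tsum_mul_right.symm
    _ ≤ _ := (h.mul_right _).tsum_le_tsum (conv_term_le f g r)
        ((summable_prod f g).subtype _)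

theorem hasSum_fibers (f g : WeightedL1 ω.toFun) :
    HasSum (fun r : S => ∑' p : {p : S × S // p.1 * p.2 = r},
      (‖f p.1.1‖ * (ω.toFun p.1.1 : ℝ)) * (‖g p.1.2‖ * (ω.toFun p.1.2 : ℝ)))
      (‖f‖ * ‖g‖) := by
  have h1 : HasSum (fun p : S × S =>
      (‖f p.1‖ * (ω.toFun p.1 : ℝ)) * (‖g p.2‖ * (ω.toFun p.2 : ℝ))) (‖f‖ * ‖g‖) :=
    f.summable.hasSum.mul g.summable.hasSum (summable_prod f g)
  have h2 := (Equiv.sigmaFiberEquiv (fun p : S × S => p.1 * p.2)).hasSum_iff.2 h1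
  exact h2.sigma (fun r => ((summable_prod f g).subtype _).hasSum)

theorem conv_summable (f g : WeightedL1 ω.toFun) :
    Summable fun r => ‖convFun f g r‖ * (ω.toFun r : ℝ) :=
  Summable.of_nonneg_of_le (fun r => mul_nonneg (norm_nonneg _) (ω.toFun r).2.le)
    (conv_norm_le f g) (hasSum_fibers f g).summable

/-- The Banach algebra `(ℓ¹(S, ω), ∗)`. -/
def ConvAlgebra (ω : Weight S) : Type _ := WeightedL1 ω.toFun

namespace ConvAlgebra

instance instNormedAddCommGroup : NormedAddCommGroup (ConvAlgebra ω) :=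
  inferInstanceAs (NormedAddCommGroup (WeightedL1 ω.toFun))

instance instNormedSpace : NormedSpace ℂ (ConvAlgebra ω) :=
  inferInstanceAs (NormedSpace ℂ (WeightedL1 ω.toFun))

instance instCompleteSpace : CompleteSpace (ConvAlgebra ω) :=
  inferInstanceAs (CompleteSpace (WeightedL1 ω.toFun))

instance instFunLike : FunLike (ConvAlgebra ω) S ℂ :=
  inferInstanceAs (FunLike (WeightedL1 ω.toFun) S ℂ)

@[ext] theorem ext {f g : ConvAlgebra ω} (h : ∀ s, f s = g s) : f = g :=
  WeightedL1.ext h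

@[simp] theorem zero_apply (s : S) : (0 : ConvAlgebra ω) s = 0 := rfl

@[simp] theorem add_apply (f g : ConvAlgebra ω) (s : S) : (f + g) s = f s + g s := rfl

@[simp] theorem smul_apply (c : ℂ) (f : ConvAlgebra ω) (s : S) : (c • f) s = c * f s := rfl

instance instMul : Mul (ConvAlgebra ω) :=
  ⟨fun f g => WeightedL1.mk (convFun f g) (conv_summable (ω := ω) f g)⟩

theorem mul_apply (f g : ConvAlgebra ω) (r : S) :
    (f * g) r = ∑' p : {p : S × S // p.1 * p.2 = r}, f p.1.1 * g p.1.2 := rfl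

theorem term_summable (f g : ConvAlgebra ω) (r : S) :
    Summable fun p : {p : S × S // p.1 * p.2 = r} => f p.1.1 * g p.1.2 :=
  (conv_term_summable (ω := ω) f g r).of_norm

theorem norm_mul_le' (f g : ConvAlgebra ω) : ‖f * g‖ ≤ ‖f‖ * ‖g‖ :=
  ((conv_summable (ω := ω) f g).tsum_le_tsum (conv_norm_le (ω := ω) f g)
    (hasSum_fibers (ω := ω) f g).summable).trans (hasSum_fibers (ω := ω) f g).tsum_eq.le

/-- The point mass `δ_s`. -/
def delta (ω : Weight S) (s : S) : ConvAlgebra ω := by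
  classical
  exact WeightedL1.mk (Pi.single s 1) (summable_of_ne_finset_zero (s := {s}) (by
    intro t ht
    have : t ≠ s := by simpa using ht
    simp [Pi.single_eq_of_ne this]))

theorem delta_self (s : S) : delta ω s s = 1 := by
  classical
  exact Pi.single_eq_same s 1

theorem delta_ne {s t : S} (h : t ≠ s) : delta ω s t = 0 := by
  classical
  exact Pi.single_eq_of_ne h 1

instance instOne : One (ConvAlgebra ω) := ⟨delta ω 1⟩

theorem one_def : (1 : ConvAlgebra ω) = delta ω 1 := rfl

theorem norm_delta (s : S) : ‖delta ω s‖ = (ω.toFun s : ℝ) := by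
  change ∑' t, ‖delta ω s t‖ * (ω.toFun t : ℝ) = _
  rw [tsum_eq_single s (fun t ht => by rw [delta_ne ht]; simp), delta_self]
  simp

theorem one_mul' (f : ConvAlgebra ω) : 1 * f = f := by
  ext r
  rw [mul_apply, tsum_eq_single ⟨(1, r), one_mul r⟩]
  · simp [one_def, delta_self]
  · rintro ⟨⟨a, b⟩, h⟩ hne
    have : a ≠ 1 := by
      rintro rfl
      apply hne
      simp only [one_mul] at h
      subst h
      rfl
    simp [one_def, delta_ne this]

theorem mul_one' (f : ConvAlgebra ω) : f * 1 = f := by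
  ext r
  rw [mul_apply, tsum_eq_single ⟨(r, 1), mul_one r⟩]
  · simp [one_def, delta_self]
  · rintro ⟨⟨a, b⟩, h⟩ hne
    have : b ≠ 1 := by
      rintro rfl
      apply hne
      simp only [mul_one] at h
      subst h
      rfl
    simp [one_def, delta_ne this]

theorem left_distrib' (f g h : ConvAlgebra ω) : f * (g + h) = f * g + f * h := by
  ext r
  rw [add_apply, mul_apply, mul_apply, mul_apply,
    ← (term_summable f g r).tsum_add (term_summable f h r)]
  exact tsum_congr (fun p => by rw [add_apply, mul_add])

theorem right_distrib' (f g h : ConvAlgebra ω) : (f + g) * h = f * h + g * h := by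
  ext r
  rw [add_apply, mul_apply, mul_apply, mul_apply,
    ← (term_summable f h r).tsum_add (term_summable g h r)]
  exact tsum_congr (fun p => by rw [add_apply, add_mul])

theorem triple_summable (f g h : ConvAlgebra ω) (r : S) :
    Summable fun q : {q : S × S × S // q.1 * (q.2.1 * q.2.2) = r} =>
      f q.1.1 * (g q.1.2.1 * h q.1.2.2) := by
  have h1 : Summable fun q : S × S × S => (‖f q.1‖ * (ω.toFun q.1 : ℝ)) *
      ((‖g q.2.1‖ * (ω.toFun q.2.1 : ℝ)) * (‖h q.2.2‖ * (ω.toFun q.2.2 : ℝ))) :=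
    (WeightedL1.summable (ν := ω.toFun) f).mul_of_nonneg (summable_prod (ω := ω) g h)
      (WeightedL1.term_nonneg (ν := ω.toFun) f)
      (fun p => mul_nonneg (WeightedL1.term_nonneg (ν := ω.toFun) g p.1)
        (WeightedL1.term_nonneg (ν := ω.toFun) h p.2))
  have h2 : Summable fun q : {q : S × S × S // q.1 * (q.2.1 * q.2.2) = r} =>
      ‖f q.1.1 * (g q.1.2.1 * h q.1.2.2)‖ * (ω.toFun r : ℝ) := by
    refine Summable.of_nonneg_of_le (fun p => mul_nonneg (norm_nonneg _) (ω.toFun r).2.le) ?_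
      (h1.subtype {q : S × S × S | q.1 * (q.2.1 * q.2.2) = r})
    rintro ⟨⟨a, b, c⟩, rfl⟩
    have e1 := ω.map_mul_le a (b * c)
    have e2 := mul_le_mul_of_nonneg_left (ω.map_mul_le b c) (ω.toFun a).2.le
    have e3 := mul_le_mul_of_nonneg_left (e1.trans e2)
      (norm_nonneg (f a * (g b * h c)))
    refine e3.trans (le_of_eq ?_)
    simp only [norm_mul, Function.comp]
    ring
  exact ((summable_mul_right_iff (ω.toFun r).2.ne').1 h2).of_norm

theorem mul_assoc' (f g h : ConvAlgebra ω) : f * g * h = f * (g * h) := by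
  ext r
  let e1 : (Σ p : {p : S × S // p.1 * p.2 = r}, {q : S × S // q.1 * q.2 = p.1.2}) ≃
      {q : S × S × S // q.1 * (q.2.1 * q.2.2) = r} :=
    { toFun := fun x => ⟨(x.1.1.1, x.2.1.1, x.2.1.2), by
        have h1 := x.1.2
        have h2 := x.2.2
        simp only [h2, h1]⟩
      invFun := fun q => ⟨⟨(q.1.1, q.1.2.1 * q.1.2.2), q.2⟩, ⟨(q.1.2.1, q.1.2.2), rfl⟩⟩
      left_inv := by
        rintro ⟨⟨⟨a, x⟩, h1⟩, ⟨⟨b, c⟩, h2⟩⟩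
        dsimp only at h2
        subst h2
        rfl
      right_inv := by rintro ⟨⟨a, b, c⟩, h⟩; rfl }
  let e2 : (Σ p : {p : S × S // p.1 * p.2 = r}, {q : S × S // q.1 * q.2 = p.1.1}) ≃
      {q : S × S × S // q.1 * (q.2.1 * q.2.2) = r} :=
    { toFun := fun x => ⟨(x.2.1.1, x.2.1.2, x.1.1.2), by
        have h1 := x.1.2
        have h2 := x.2.2
        simp only [← mul_assoc, h2, h1]⟩
      invFun := fun q => ⟨⟨(q.1.1 * q.1.2.1, q.1.2.2), by simpa [mul_assoc] using q.2⟩,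
        ⟨(q.1.1, q.1.2.1), rfl⟩⟩
      left_inv := by
        rintro ⟨⟨⟨x, c⟩, h1⟩, ⟨⟨a, b⟩, h2⟩⟩
        dsimp only at h2
        subst h2
        rfl
      right_inv := by rintro ⟨⟨a, b, c⟩, h⟩; rfl }
  have hs := triple_summable f g h r
  have s1 := e1.summable_iff.2 hs
  have s2 := e2.summable_iff.2 hs
  have t1 := (e1.tsum_eq (fun q => f q.1.1 * (g q.1.2.1 * h q.1.2.2))).symm.trans s1.tsum_sigma
  have t2 := (e2.tsum_eq (fun q => f q.1.1 * (g q.1.2.1 * h q.1.2.2))).symm.trans s2.tsum_sigma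
  have L : (f * g * h) r = ∑' q : {q : S × S × S // q.1 * (q.2.1 * q.2.2) = r},
      f q.1.1 * (g q.1.2.1 * h q.1.2.2) := by
    rw [t2, mul_apply]
    refine tsum_congr (fun p => ?_)
    rw [mul_apply, ← tsum_mul_right]
    exact tsum_congr (fun q => mul_assoc _ _ _)
  have R : (f * (g * h)) r = ∑' q : {q : S × S × S // q.1 * (q.2.1 * q.2.2) = r},
      f q.1.1 * (g q.1.2.1 * h q.1.2.2) := by
    rw [t1, mul_apply]
    refine tsum_congr (fun p => ?_)
    rw [mul_apply, ← tsum_mul_left]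
    rfl
  rw [L, R]

theorem smul_mul' (c : ℂ) (f g : ConvAlgebra ω) : c • f * g = c • (f * g) := by
  ext r
  rw [smul_apply, mul_apply, mul_apply, ← tsum_mul_left]
  exact tsum_congr (fun p => by rw [smul_apply, mul_assoc])

theorem mul_smul' (c : ℂ) (f g : ConvAlgebra ω) : f * c • g = c • (f * g) := by
  ext r
  rw [smul_apply, mul_apply, mul_apply, ← tsum_mul_left]
  exact tsum_congr (fun p => by rw [smul_apply, mul_left_comm])

theorem zero_mul' (f : ConvAlgebra ω) : 0 * f = 0 := by
  ext r; rw [mul_apply]; simp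

theorem mul_zero' (f : ConvAlgebra ω) : f * 0 = 0 := by
  ext r; rw [mul_apply]; simp

instance instNormedRing : NormedRing (ConvAlgebra ω) :=
  { instNormedAddCommGroup with
    mul := (· * ·)
    one := 1
    left_distrib := left_distrib'
    right_distrib := right_distrib'
    zero_mul := zero_mul'
    mul_zero := mul_zero'
    mul_assoc := mul_assoc'
    one_mul := one_mul'
    mul_one := mul_one'
    norm_mul_le := norm_mul_le' }

instance instAlgebra : Algebra ℂ (ConvAlgebra ω) := Algebra.ofModule smul_mul' mul_smul'

instance instNormedAlgebra : NormedAlgebra ℂ (ConvAlgebra ω) where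
  norm_smul_le := norm_smul_le

instance instNormOneClass : NormOneClass (ConvAlgebra ω) :=
  ⟨by rw [one_def, norm_delta, ω.map_one]⟩

end ConvAlgebra

end Convolution

/-! ### The contracted algebra `(ℓ¹(S ∖ {◇}, μ), #)`

Here `S` is a monoid with a zero element `◇ = 0 ≠ 1`, and `μ` is the restriction to `S ∖ {◇}` of
a weight `ω` on `S`. The product is that of `ℓ¹(S, ω) / ℂ δ_◇`, transported along the isometric
bijection induced by the restriction map `ℓ¹(S, ω) → ℓ¹(S ∖ {◇}, μ)`. -/

/-- The quasi-weight on `S ∖ {◇}` which is the restriction of the weight `ω`. -/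
def Weight.quasi {S : Type*} [MonoidWithZero S] (ω : Weight S) :
    {s : S // s ≠ 0} → Set.Ioi (0 : ℝ) := fun s => ω.toFun s.1

/-- The Banach algebra `(ℓ¹(S ∖ {◇}, μ), #)`, where `μ` is the restriction of `ω`. -/
def ContractedAlgebra {S : Type*} [MonoidWithZero S] (ω : Weight S) : Type _ :=
  WeightedL1 ω.quasi

namespace ContractedAlgebra

variable {S : Type*} [MonoidWithZero S] {ω : Weight S}

instance instNormedAddCommGroup : NormedAddCommGroup (ContractedAlgebra ω) :=
  inferInstanceAs (NormedAddCommGroup (WeightedL1 ω.quasi))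

instance instNormedSpace : NormedSpace ℂ (ContractedAlgebra ω) :=
  inferInstanceAs (NormedSpace ℂ (WeightedL1 ω.quasi))

instance instCompleteSpace : CompleteSpace (ContractedAlgebra ω) :=
  inferInstanceAs (CompleteSpace (WeightedL1 ω.quasi))

instance instFunLike : FunLike (ContractedAlgebra ω) {s : S // s ≠ 0} ℂ :=
  inferInstanceAs (FunLike (WeightedL1 ω.quasi) {s : S // s ≠ 0} ℂ)

@[ext] theorem ext {f g : ContractedAlgebra ω} (h : ∀ s, f s = g s) : f = g :=
  WeightedL1.ext h

/-- The restriction map `ψ : ℓ¹(S, ω) → ℓ¹(S ∖ {◇}, μ)`. -/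
def restrict : ConvAlgebra ω →ₗ[ℂ] ContractedAlgebra ω where
  toFun F := WeightedL1.mk (fun s => F s.1)
    ((WeightedL1.summable (ν := ω.toFun) F).subtype {s : S | s ≠ 0})
  map_add' _ _ := rfl
  map_smul' _ _ := rfl

@[simp] theorem restrict_apply (F : ConvAlgebra ω) (s : {s : S // s ≠ 0}) :
    restrict F s = F s.1 := rfl

open Classical in
/-- The function on `S` extending `f` by `0` at `◇`. -/
def extendFun (f : {s : S // s ≠ 0} → ℂ) (s : S) : ℂ := if h : s = 0 then 0 else f ⟨s, h⟩

theorem hasSum_extend (f : ContractedAlgebra ω) :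
    HasSum (fun s => ‖extendFun f s‖ * (ω.toFun s : ℝ)) ‖f‖ := by
  have h1 : HasSum (fun s : {s : S // s ≠ 0} => ‖f s‖ * (ω.quasi s : ℝ)) ‖f‖ :=
    (WeightedL1.summable (ν := ω.quasi) f).hasSum
  refine (hasSum_subtype_iff_of_support_subset (s := {s : S | s ≠ 0}) ?_).1 ?_
  · intro s hs hs0
    apply hs
    simp [extendFun, hs0]
  · have e : (fun s => ‖extendFun f s‖ * (ω.toFun s : ℝ)) ∘ (Subtype.val : {s : S | s ≠ 0} → S) =
        fun s : {s : S // s ≠ 0} => ‖f s‖ * (ω.quasi s : ℝ) := by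
      funext s
      have hs : s.1 ≠ 0 := s.2
      simp [extendFun, hs, Weight.quasi]
    rw [e]
    exact h1

/-- Extension by `0` at `◇`, a right inverse of the restriction map. -/
def extend (f : ContractedAlgebra ω) : ConvAlgebra ω :=
  WeightedL1.mk (extendFun f) (hasSum_extend f).summable

theorem extend_coe (f : ContractedAlgebra ω) (s : {s : S // s ≠ 0}) : extend f s.1 = f s := by
  change extendFun f s.1 = f s
  simp [extendFun, s.2]

@[simp] theorem restrict_extend (f : ContractedAlgebra ω) : restrict (extend f) = f := by
  ext s
  rw [restrict_apply, extend_coe]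

theorem restrict_surjective :
    Function.Surjective (restrict : ConvAlgebra ω → ContractedAlgebra ω) :=
  fun f => ⟨extend f, restrict_extend f⟩

theorem norm_extend (f : ContractedAlgebra ω) : ‖extend f‖ = ‖f‖ := (hasSum_extend f).tsum_eq

theorem norm_restrict_le (F : ConvAlgebra ω) : ‖restrict F‖ ≤ ‖F‖ :=
  (WeightedL1.summable (ν := ω.toFun) F).tsum_subtype_le _ {s : S | s ≠ 0}
    (WeightedL1.term_nonneg (ν := ω.toFun) F)

/-- The product `#`: lift to `ℓ¹(S, ω)`, convolve there, and restrict to `S ∖ {◇}`. By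
`restrict_mul` below the choice of the lifts does not matter. -/
instance instMul : Mul (ContractedAlgebra ω) := ⟨fun f g => restrict (extend f * extend g)⟩

instance instOne : One (ContractedAlgebra ω) := ⟨restrict 1⟩

theorem restrict_one : restrict (1 : ConvAlgebra ω) = 1 := rfl

theorem mul_congr {F F' G G' : ConvAlgebra ω} (hF : restrict F = restrict F')
    (hG : restrict G = restrict G') : restrict (F * G) = restrict (F' * G') := by
  have key : ∀ {F F' : ConvAlgebra ω}, restrict F = restrict F' → ∀ s : S, s ≠ 0 → F s = F' s :=
    fun h s hs => congrArg (fun f : ContractedAlgebra ω => f ⟨s, hs⟩) h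
  ext ⟨r, hr⟩
  simp only [restrict_apply, ConvAlgebra.mul_apply]
  refine tsum_congr ?_
  rintro ⟨⟨a, b⟩, rfl⟩
  simp only [key hF a (left_ne_zero_of_mul hr), key hG b (right_ne_zero_of_mul hr)]

/-- The restriction map is multiplicative from `∗` to `#`. -/
theorem restrict_mul (F G : ConvAlgebra ω) : restrict (F * G) = restrict F * restrict G :=
  mul_congr (restrict_extend _).symm (restrict_extend _).symm

instance instNormedRing : NormedRing (ContractedAlgebra ω) :=
  { instNormedAddCommGroup with
    mul := (· * ·)
    one := 1
    left_distrib := by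
      intro f g h
      obtain ⟨F, rfl⟩ := restrict_surjective f
      obtain ⟨G, rfl⟩ := restrict_surjective g
      obtain ⟨H, rfl⟩ := restrict_surjective h
      rw [← map_add, ← restrict_mul, ← restrict_mul, ← restrict_mul, mul_add, map_add]
    right_distrib := by
      intro f g h
      obtain ⟨F, rfl⟩ := restrict_surjective f
      obtain ⟨G, rfl⟩ := restrict_surjective g
      obtain ⟨H, rfl⟩ := restrict_surjective h
      rw [← map_add, ← restrict_mul, ← restrict_mul, ← restrict_mul, add_mul, map_add]
    zero_mul := by
      intro f
      obtain ⟨F, rfl⟩ := restrict_surjective f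
      rw [← map_zero restrict, ← restrict_mul, zero_mul]
    mul_zero := by
      intro f
      obtain ⟨F, rfl⟩ := restrict_surjective f
      rw [← map_zero restrict, ← restrict_mul, mul_zero]
    mul_assoc := by
      intro f g h
      obtain ⟨F, rfl⟩ := restrict_surjective f
      obtain ⟨G, rfl⟩ := restrict_surjective g
      obtain ⟨H, rfl⟩ := restrict_surjective h
      rw [← restrict_mul, ← restrict_mul, ← restrict_mul, ← restrict_mul, mul_assoc]
    one_mul := by
      intro f
      obtain ⟨F, rfl⟩ := restrict_surjective f
      rw [← restrict_one, ← restrict_mul, one_mul]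
    mul_one := by
      intro f
      obtain ⟨F, rfl⟩ := restrict_surjective f
      rw [← restrict_one, ← restrict_mul, mul_one]
    norm_mul_le := by
      intro f g
      refine (norm_restrict_le _).trans ((norm_mul_le _ _).trans ?_)
      rw [norm_extend, norm_extend] }

instance instAlgebra : Algebra ℂ (ContractedAlgebra ω) :=
  Algebra.ofModule
    (by
      intro c f g
      obtain ⟨F, rfl⟩ := restrict_surjective f
      obtain ⟨G, rfl⟩ := restrict_surjective g
      rw [← map_smul, ← restrict_mul, ← restrict_mul, smul_mul_assoc, map_smul])
    (by
      intro c f g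
      obtain ⟨F, rfl⟩ := restrict_surjective f
      obtain ⟨G, rfl⟩ := restrict_surjective g
      rw [← map_smul, ← restrict_mul, ← restrict_mul, mul_smul_comm, map_smul])

instance instNormedAlgebra : NormedAlgebra ℂ (ContractedAlgebra ω) where
  norm_smul_le := norm_smul_le

instance instNormOneClass [Nontrivial S] : NormOneClass (ContractedAlgebra ω) := by
  refine ⟨?_⟩
  change ∑' s : {s : S // s ≠ 0}, ‖ConvAlgebra.delta ω 1 s.1‖ * (ω.toFun s.1 : ℝ) = 1
  rw [tsum_eq_single ⟨1, one_ne_zero⟩ (fun t ht => ?_)]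
  · rw [ConvAlgebra.delta_self, ω.map_one]
    simp
  · have : t.1 ≠ 1 := fun h => ht (Subtype.ext h)
    rw [ConvAlgebra.delta_ne this]
    simp

end ContractedAlgebra

/-! ### The second Cuntz semigroup -/

/-- The generators `a₁, a₂, b₁, b₂` (indexed by `Fin 2`). -/
inductive Cu2Gen : Type
  | a (i : Fin 2) : Cu2Gen
  | b (i : Fin 2) : Cu2Gen

/-- The word `a_i b_j` in the free monoid with zero on the generators. -/
def cu2Word (i j : Fin 2) : WithZero (FreeMonoid Cu2Gen) :=
  ((FreeMonoid.of (Cu2Gen.a i) * FreeMonoid.of (Cu2Gen.b j) : FreeMonoid Cu2Gen) :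
    WithZero (FreeMonoid Cu2Gen))

/-- The relations `a_i b_i = e` and `a_i b_j = ◇` for `i ≠ j`. -/
inductive Cu2Rel : WithZero (FreeMonoid Cu2Gen) → WithZero (FreeMonoid Cu2Gen) → Prop
  | eq_one (i : Fin 2) : Cu2Rel (cu2Word i i) 1
  | eq_zero (i j : Fin 2) (h : i ≠ j) : Cu2Rel (cu2Word i j) 0

/-- The second Cuntz semigroup: the monoid with zero presented by
`⟨a₁, a₂, b₁, b₂ : a₁ b₁ = e = a₂ b₂, a₁ b₂ = ◇ = a₂ b₁⟩`. -/
def Cu2 : Type := (conGen Cu2Rel).Quotient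

namespace Cu2

instance instMonoid : Monoid Cu2 := inferInstanceAs (Monoid (conGen Cu2Rel).Quotient)

/-- The quotient map. -/
def mk : WithZero (FreeMonoid Cu2Gen) →* Cu2 := (conGen Cu2Rel).mk'

theorem mk_surjective : Function.Surjective mk := Con.mk'_surjective

instance instMonoidWithZero : MonoidWithZero Cu2 where
  zero := mk 0
  zero_mul x := by
    obtain ⟨w, rfl⟩ := mk_surjective x
    exact (map_mul mk 0 w).symm.trans (by rw [zero_mul]; rfl)
  mul_zero x := by
    obtain ⟨w, rfl⟩ := mk_surjective x
    exact (map_mul mk w 0).symm.trans (by rw [mul_zero]; rfl)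

/-- The generator `a_i`. -/
def a (i : Fin 2) : Cu2 := mk (FreeMonoid.of (Cu2Gen.a i) : FreeMonoid Cu2Gen)

/-- The generator `b_i`. -/
def b (i : Fin 2) : Cu2 := mk (FreeMonoid.of (Cu2Gen.b i) : FreeMonoid Cu2Gen)

theorem a_mul_b_self (i : Fin 2) : a i * b i = 1 :=
  (Con.eq (conGen Cu2Rel)).2 (ConGen.Rel.of _ _ (Cu2Rel.eq_one i))

theorem a_mul_b_of_ne {i j : Fin 2} (h : i ≠ j) : a i * b j = 0 :=
  (Con.eq (conGen Cu2Rel)).2 (ConGen.Rel.of _ _ (Cu2Rel.eq_zero i j h))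

/-- Universal property: elements of a monoid with zero that satisfy the relations define a
homomorphism from `Cu2`. -/
def lift {M : Type*} [MonoidWithZero M] (x y : Fin 2 → M) (h1 : ∀ i, x i * y i = 1)
    (h0 : ∀ i j, i ≠ j → x i * y j = 0) : Cu2 →* M :=
  (conGen Cu2Rel).lift
    (WithZero.lift' (FreeMonoid.lift (fun g : Cu2Gen => match g with
      | .a i => x i
      | .b i => y i)) : WithZero (FreeMonoid Cu2Gen) →*₀ M).toMonoidHom
    (by
      refine Con.conGen_le.2 ?_
      intro u v huv
      cases huv with
      | eq_one i => simp [Con.ker_rel, cu2Word, h1]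
      | eq_zero i j h => simp [Con.ker_rel, cu2Word, h0 i j h])

theorem lift_zero {M : Type*} [MonoidWithZero M] (x y : Fin 2 → M) (h1 : ∀ i, x i * y i = 1)
    (h0 : ∀ i j, i ≠ j → x i * y j = 0) : lift x y h1 h0 0 = 0 :=
  map_zero (WithZero.lift' (FreeMonoid.lift (fun g : Cu2Gen => match g with
      | .a i => x i
      | .b i => y i)) : WithZero (FreeMonoid Cu2Gen) →*₀ M)

/-- `e ≠ ◇`, seen in the action of the generators on `ℤ`-valued sequences. -/
instance instNontrivial : Nontrivial Cu2 := by
  let x : Fin 2 → Module.End ℤ (ℕ → ℤ) := fun i =>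
    { toFun := fun f n => f (2 * n + i)
      map_add' := fun _ _ => rfl
      map_smul' := fun _ _ => rfl }
  let y : Fin 2 → Module.End ℤ (ℕ → ℤ) := fun i =>
    { toFun := fun f n => if n % 2 = i then f (n / 2) else 0
      map_add' := fun f g => by
        ext n
        by_cases h : n % 2 = (i : ℕ) <;> simp [h]
      map_smul' := fun c f => by
        ext n
        by_cases h : n % 2 = (i : ℕ) <;> simp [h] }
  have hxy : ∀ i j f n, (x i * y j) f n = if i = j then f n else 0 := by
    intro i j f n
    change (if (2 * n + (i : ℕ)) % 2 = (j : ℕ) then f ((2 * n + i) / 2) else 0) = _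
    have hi := i.2
    have e1 : (2 * n + (i : ℕ)) % 2 = i := by omega
    have e2 : (2 * n + (i : ℕ)) / 2 = n := by omega
    rw [e1, e2]
    simp [Fin.ext_iff]
  have h1 : ∀ i, x i * y i = 1 := fun i => by
    ext f n
    simp [hxy]
  have h0 : ∀ i j, i ≠ j → x i * y j = 0 := fun i j h => by
    ext f n
    simp [hxy, h]
  refine ⟨⟨0, 1, fun h => ?_⟩⟩
  have := congrArg (lift x y h1 h0) h
  rw [lift_zero, map_one] at this
  exact zero_ne_one this

open Classical in
/-- The weight `ω_n` on `Cu2` with `ω_n(e) = ω_n(◇) = 1`, and `ω_n(s) = n` otherwise; its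
restriction to `Cu2 ∖ {◇}` is the quasi-weight `μ_n`. -/
def weight (n : ℕ+) : Weight Cu2 where
  toFun s := if s = 1 ∨ s = 0 then ⟨1, Set.mem_Ioi.2 one_pos⟩
    else ⟨(n : ℝ), Set.mem_Ioi.2 (by exact_mod_cast n.pos)⟩
  map_one := by simp
  map_mul_le s t := by
    have hn : (1 : ℝ) ≤ (n : ℝ) := by exact_mod_cast n.pos
    by_cases hs : s = 1
    · simp [hs]
    by_cases ht : t = 1
    · simp [ht]
    by_cases hs0 : s = 0
    · by_cases ht0 : t = 0 <;> simp [hs0, ht0, ht, hn]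
    by_cases ht0 : t = 0
    · simp [hs0, ht0, hs, hn]
    by_cases hst : s * t = 1 ∨ s * t = 0
    · simp only [hst, hs, ht, hs0, ht0, or_self, if_true, if_false]
      nlinarith
    · simp only [hst, hs, ht, hs0, ht0, or_self, if_false]
      nlinarith

end Cu2

/-- The algebras `𝒜_n = (ℓ¹(Cu₂ ∖ {◇}, μ_n), #)`, for `n ≥ 1`. -/
abbrev CuAlgebra (n : ℕ+) : Type := ContractedAlgebra (Cu2.weight n)

/-! ### Asymptotic sequence algebras -/

section Asy

variable (B : ℕ+ → Type*) [∀ n, NormedRing (B n)] [∀ n, NormOneClass (B n)]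

/-- The ideal `c₀(B_n)` of `ℓ^∞(B_n)`: the sequences with `‖a_n‖ → 0`. -/
def c0Ideal : Ideal (lp B ∞) where
  carrier := {A | Tendsto (fun n => ‖A n‖) atTop (𝓝 0)}
  zero_mem' := by simp
  add_mem' := by
    intro A A' hA hA'
    refine squeeze_zero (fun n => norm_nonneg _) (fun n => norm_add_le (A n) (A' n)) ?_
    simpa using Tendsto.add hA hA'
  smul_mem' := by
    intro C A hA
    refine squeeze_zero (fun n => norm_nonneg _) (fun n => ?_)
      (by simpa using Tendsto.const_mul ‖C‖ hA)
    exact (norm_mul_le (C n) (A n)).trans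
      (mul_le_mul_of_nonneg_right (lp.norm_apply_le_norm (by simp) C n) (norm_nonneg _))

instance c0Ideal_isTwoSided : (c0Ideal B).IsTwoSided where
  mul_mem_of_left := by
    intro A C hA
    refine squeeze_zero (fun n => norm_nonneg _) (fun n => ?_)
      (by simpa using Tendsto.mul_const ‖C‖ hA)
    exact (norm_mul_le (A n) (C n)).trans
      (mul_le_mul_of_nonneg_left (lp.norm_apply_le_norm (by simp) C n) (norm_nonneg _))

/-- The asymptotic sequence algebra `Asy(B_n) = ℓ^∞(B_n) / c₀(B_n)`. -/
abbrev Asy : Type _ := lp B ∞ ⧸ c0Ideal B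

end Asy

/-! ### Proper infiniteness -/

/-- Equivalence `p ∼ q` of idempotents: `p = ab` and `q = ba` for some `a`, `b`. -/
def IdemEquiv {R : Type*} [Ring R] (p q : R) : Prop := ∃ a b : R, p = a * b ∧ q = b * a

/-- A unital ring (algebra) is properly infinite if it has orthogonal idempotents `p`, `q` with
`p ∼ 1` and `q ∼ 1`. -/
def IsProperlyInfinite (R : Type*) [Ring R] : Prop :=
  ∃ p q : R, IsIdempotentElem p ∧ IsIdempotentElem q ∧ p * q = 0 ∧ q * p = 0 ∧
    IdemEquiv p 1 ∧ IdemEquiv q 1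

end

/-!
Proper infiniteness of a ring amounts to elements `y₁, y₂, x₁, x₂` with `y₁ x₁ = 1 = y₂ x₂` and
`y₁ x₂ = 0 = y₂ x₁` (`isProperlyInfinite_iff`). In each `𝒜_n` the point masses at the generators of
`Cu₂` are such elements.

In `Asy(𝒜_n)` they cannot exist. The evaluation `f ↦ f(e)` is contractive, and it is nearly
multiplicative on `𝒜_n` for large `n`: the difference `(f # g)(e) - f(e) g(e)` only involves products
`f(s) g(t)` with `s t = e` and `s, t ∉ {e, ◇}`, and each of these carries the weight `n²`, so
`|(f # g)(e) - f(e) g(e)| ≤ ‖f‖ ‖g‖ / n²` (`CuAlgebra.norm_mul_apply_one_sub_le`). Elements of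
`Asy(𝒜_n)` as above would thus yield scalar sequences with `y₁ x₁ → 1`, `y₂ x₂ → 1`, `y₁ x₂ → 0` and
`y₂ x₁ → 0`, which is absurd because `(y₁ x₁) (y₂ x₂) = (y₁ x₂) (y₂ x₁)`.
-/

/-- The idempotents `x₁ y₁` and `x₂ y₂` witness proper infiniteness. -/
theorem isProperlyInfinite_iff {R : Type*} [Ring R] :
    IsProperlyInfinite R ↔
      ∃ y₁ x₁ y₂ x₂ : R, y₁ * x₁ = 1 ∧ y₂ * x₂ = 1 ∧ y₁ * x₂ = 0 ∧ y₂ * x₁ = 0 := by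
  constructor
  · rintro ⟨p, q, -, -, hpq, hqp, ⟨x₁, y₁, rfl, h₁⟩, ⟨x₂, y₂, rfl, h₂⟩⟩
    refine ⟨y₁, x₁, y₂, x₂, h₁.symm, h₂.symm, ?_, ?_⟩
    · calc y₁ * x₂ = (y₁ * x₁) * (y₁ * x₂) * (y₂ * x₂) := by rw [← h₁, ← h₂, one_mul, mul_one]
        _ = y₁ * ((x₁ * y₁) * (x₂ * y₂)) * x₂ := by simp only [mul_assoc]
        _ = 0 := by rw [hpq, mul_zero, zero_mul]
    · calc y₂ * x₁ = (y₂ * x₂) * (y₂ * x₁) * (y₁ * x₁) := by rw [← h₁, ← h₂, one_mul, mul_one]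
        _ = y₂ * ((x₂ * y₂) * (x₁ * y₁)) * x₁ := by simp only [mul_assoc]
        _ = 0 := by rw [hqp, mul_zero, zero_mul]
  · rintro ⟨y₁, x₁, y₂, x₂, h₁, h₂, h₁₂, h₂₁⟩
    have key : ∀ x y x' y' : R, (x * y) * (x' * y') = x * (y * x') * y' := fun x y x' y' => by
      simp only [mul_assoc]
    refine ⟨x₁ * y₁, x₂ * y₂, ?_, ?_, ?_, ?_, ⟨x₁, y₁, rfl, h₁.symm⟩, ⟨x₂, y₂, rfl, h₂.symm⟩⟩
    · rw [IsIdempotentElem, key, h₁, mul_one]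
    · rw [IsIdempotentElem, key, h₂, mul_one]
    · rw [key, h₁₂, mul_zero, zero_mul]
    · rw [key, h₂₁, mul_zero, zero_mul]

namespace ConvAlgebra

variable {S : Type*} [Monoid S] {ω : Weight S}

theorem delta_mul_delta (s t : S) : delta ω s * delta ω t = delta ω (s * t) := by
  ext r
  rw [mul_apply]
  by_cases hr : s * t = r
  · subst hr
    rw [tsum_eq_single ⟨(s, t), rfl⟩]
    · simp only [delta_self, mul_one]
    · rintro ⟨⟨a, b⟩, h⟩ hne
      by_cases ha : a = s
      · have hb : b ≠ t := by
          rintro rfl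
          subst ha
          exact hne rfl
        simp only [delta_ne hb, mul_zero]
      · simp only [delta_ne ha, zero_mul]
  · rw [delta_ne (Ne.symm hr)]
    refine (tsum_congr ?_).trans tsum_zero
    rintro ⟨⟨a, b⟩, h⟩
    by_cases ha : a = s
    · have hb : b ≠ t := by
        rintro rfl
        subst ha
        exact hr h
      simp only [delta_ne hb, mul_zero]
    · simp only [delta_ne ha, zero_mul]

/-- If all nontrivial factorisations of `1` have weight at least `c`, then evaluation at `1` is
multiplicative up to an error of order `1 / c`. -/
theorem norm_mul_apply_one_sub_le {c : ℝ} (hc : 0 < c)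
    (hω : ∀ s t : S, s * t = 1 → s ≠ 1 → c ≤ (ω.toFun s : ℝ) * ω.toFun t)
    (F G : ConvAlgebra ω) : ‖(F * G) 1 - F 1 * G 1‖ ≤ ‖F‖ * ‖G‖ / c := by
  classical
  let T : S × S → ℝ := fun p =>
    (‖F p.1‖ * (ω.toFun p.1 : ℝ)) * (‖G p.2‖ * (ω.toFun p.2 : ℝ))
  have hT : Summable T := summable_prod (ω := ω) F G
  have hT0 : ∀ p, 0 ≤ T p := fun p =>
    mul_nonneg (WeightedL1.term_nonneg (ν := ω.toFun) F p.1)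
      (WeightedL1.term_nonneg (ν := ω.toFun) G p.2)
  have hTsum : ∑' p, T p = ‖F‖ * ‖G‖ :=
    ((WeightedL1.summable (ν := ω.toFun) F).hasSum.mul
      (WeightedL1.summable (ν := ω.toFun) G).hasSum hT).tsum_eq
  let o : {p : S × S // p.1 * p.2 = 1} := ⟨(1, 1), one_mul 1⟩
  have hsplit := (term_summable F G 1).tsum_eq_add_tsum_ite o
  rw [mul_apply, hsplit, add_sub_cancel_left]
  have hTs : Summable fun p : {p : S × S // p.1 * p.2 = 1} => T p.1 :=
    hT.subtype {p : S × S | p.1 * p.2 = 1}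
  refine (tsum_of_norm_bounded (hTs.hasSum.div_const c) ?_).trans ?_
  · rintro ⟨⟨s, t⟩, hst⟩
    split_ifs with h
    · rw [norm_zero]
      exact div_nonneg (hT0 _) hc.le
    · have hs : s ≠ 1 := by
        rintro rfl
        have ht : t = 1 := by simpa using hst
        exact h (Subtype.ext (Prod.ext rfl ht))
      rw [le_div_iff₀ hc, norm_mul]
      calc ‖F s‖ * ‖G t‖ * c ≤ ‖F s‖ * ‖G t‖ * ((ω.toFun s : ℝ) * ω.toFun t) :=
            mul_le_mul_of_nonneg_left (hω s t hst hs) (by positivity)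
        _ = T (s, t) := by simp only [T]; ring
  · rw [← hTsum]
    exact div_le_div_of_nonneg_right
      (hT.tsum_subtype_le T {p : S × S | p.1 * p.2 = 1} hT0) hc.le

end ConvAlgebra

namespace ContractedAlgebra

variable {S : Type*} [MonoidWithZero S] {ω : Weight S}

theorem restrict_delta_zero : restrict (ConvAlgebra.delta ω 0) = 0 := by
  ext s
  exact ConvAlgebra.delta_ne (ω := ω) s.2

theorem restrict_delta_mul (s t : S) :
    restrict (ConvAlgebra.delta ω s) * restrict (ConvAlgebra.delta ω t) =
      restrict (ConvAlgebra.delta ω (s * t)) := by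
  rw [← restrict_mul, ConvAlgebra.delta_mul_delta]

variable [Nontrivial S]

theorem norm_apply_one_le (f : ContractedAlgebra ω) : ‖f ⟨1, one_ne_zero⟩‖ ≤ ‖f‖ := by
  have h := (WeightedL1.summable (ν := ω.quasi) f).le_tsum ⟨1, one_ne_zero⟩
    (fun s _ => WeightedL1.term_nonneg (ν := ω.quasi) f s)
  have h1 : (ω.quasi ⟨1, one_ne_zero⟩ : ℝ) = 1 := ω.map_one
  rw [h1, mul_one] at h
  exact h

theorem norm_mul_apply_one_sub_le {c : ℝ} (hc : 0 < c)
    (hω : ∀ s t : S, s * t = 1 → s ≠ 1 → c ≤ (ω.toFun s : ℝ) * ω.toFun t)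
    (f g : ContractedAlgebra ω) :
    ‖(f * g) ⟨1, one_ne_zero⟩ - f ⟨1, one_ne_zero⟩ * g ⟨1, one_ne_zero⟩‖ ≤ ‖f‖ * ‖g‖ / c := by
  have h := ConvAlgebra.norm_mul_apply_one_sub_le hc hω (extend f) (extend g)
  rw [norm_extend, norm_extend] at h
  have ef := extend_coe f ⟨1, one_ne_zero⟩
  have eg := extend_coe g ⟨1, one_ne_zero⟩
  rw [← ef, ← eg]
  exact h

theorem one_apply_one : (1 : ContractedAlgebra ω) ⟨1, one_ne_zero⟩ = 1 :=
  ConvAlgebra.delta_self (ω := ω) 1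

end ContractedAlgebra

namespace Cu2

theorem weight_of_ne {n : ℕ+} {s : Cu2} (h1 : s ≠ 1) (h0 : s ≠ 0) :
    ((weight n).toFun s : ℝ) = n := by
  simp [weight, h1, h0]

theorem sq_le_weight_mul_weight (n : ℕ+) {s t : Cu2} (hst : s * t = 1) (hs : s ≠ 1) :
    (n : ℝ) ^ 2 ≤ ((weight n).toFun s : ℝ) * (weight n).toFun t := by
  have ht : t ≠ 1 := by
    rintro rfl
    exact hs (by simpa using hst)
  have hst0 : s * t ≠ 0 := by
    rw [hst]
    exact one_ne_zero
  rw [weight_of_ne hs (left_ne_zero_of_mul hst0), weight_of_ne ht (right_ne_zero_of_mul hst0), sq]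

end Cu2

namespace CuAlgebra

theorem isProperlyInfinite (n : ℕ+) : IsProperlyInfinite (CuAlgebra n) := by
  let d : Cu2 → CuAlgebra n := fun s => ContractedAlgebra.restrict (ConvAlgebra.delta _ s)
  have hd : ∀ s t, d s * d t = d (s * t) := ContractedAlgebra.restrict_delta_mul
  have h1 : d 1 = 1 := rfl
  have h0 : d 0 = 0 := ContractedAlgebra.restrict_delta_zero
  refine isProperlyInfinite_iff.2 ⟨d (Cu2.a 0), d (Cu2.b 0), d (Cu2.a 1), d (Cu2.b 1), ?_⟩
  simp only [hd, Cu2.a_mul_b_self, Cu2.a_mul_b_of_ne zero_ne_one, Cu2.a_mul_b_of_ne one_ne_zero,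
    h0, h1, and_self]

/-- Evaluation at the identity `e` of `Cu₂`. -/
noncomputable def evalOne {n : ℕ+} (f : CuAlgebra n) : ℂ := f ⟨1, one_ne_zero⟩

theorem norm_mul_apply_one_sub_le {n : ℕ+} (f g : CuAlgebra n) :
    ‖evalOne (f * g) - evalOne f * evalOne g‖ ≤ ‖f‖ * ‖g‖ / (n : ℝ) ^ 2 :=
  ContractedAlgebra.norm_mul_apply_one_sub_le (by have := n.pos; positivity)
    (fun _ _ hst hs => Cu2.sq_le_weight_mul_weight n hst hs) f g

theorem tendsto_coe_pnat_atTop : Tendsto (fun n : ℕ+ => (n : ℝ)) atTop atTop :=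
  tendsto_natCast_atTop_atTop.comp tendsto_PNat_val_atTop_atTop

theorem tendsto_evalOne_mul_sub (A C : lp CuAlgebra ∞) :
    Tendsto (fun n => evalOne ((A * C) n) - evalOne (A n) * evalOne (C n)) atTop (𝓝 0) := by
  have hlim : Tendsto (fun n : ℕ+ => ‖A‖ * ‖C‖ / (n : ℝ) ^ 2) atTop (𝓝 0) :=
    tendsto_const_nhds.div_atTop
      ((tendsto_pow_atTop two_ne_zero).comp tendsto_coe_pnat_atTop)
  refine squeeze_zero_norm (fun n => (norm_mul_apply_one_sub_le (A n) (C n)).trans ?_) hlim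
  gcongr
  · exact lp.norm_apply_le_norm (by simp) A n
  · exact lp.norm_apply_le_norm (by simp) C n

/-- Evaluation at `e` is multiplicative on `Asy(𝒜_n)`, in the limit. -/
theorem tendsto_evalOne_mul_evalOne_sub {A C D : lp CuAlgebra ∞}
    (h : Ideal.Quotient.mk (c0Ideal CuAlgebra) A * Ideal.Quotient.mk (c0Ideal CuAlgebra) C =
      Ideal.Quotient.mk (c0Ideal CuAlgebra) D) :
    Tendsto (fun n => evalOne (A n) * evalOne (C n) - evalOne (D n)) atTop (𝓝 0) := by
  rw [← map_mul, Ideal.Quotient.eq] at h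
  have h1 : Tendsto (fun n => evalOne ((A * C) n) - evalOne (D n)) atTop (𝓝 0) :=
    squeeze_zero_norm
      (fun n => ContractedAlgebra.norm_apply_one_le ((A * C - D) n)) h
  have h2 := h1.sub (tendsto_evalOne_mul_sub A C)
  rw [sub_zero] at h2
  refine h2.congr fun n => ?_
  ring

theorem not_isProperlyInfinite_asy : ¬ IsProperlyInfinite (Asy CuAlgebra) := by
  rw [isProperlyInfinite_iff]
  rintro ⟨y₁, x₁, y₂, x₂, h₁, h₂, h₁₂, h₂₁⟩
  obtain ⟨Y₁, rfl⟩ := Ideal.Quotient.mk_surjective y₁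
  obtain ⟨X₁, rfl⟩ := Ideal.Quotient.mk_surjective x₁
  obtain ⟨Y₂, rfl⟩ := Ideal.Quotient.mk_surjective y₂
  obtain ⟨X₂, rfl⟩ := Ideal.Quotient.mk_surjective x₂
  have one_case : ∀ {A C : lp CuAlgebra ∞},
      Ideal.Quotient.mk (c0Ideal CuAlgebra) A * Ideal.Quotient.mk (c0Ideal CuAlgebra) C = 1 →
      Tendsto (fun n => evalOne (A n) * evalOne (C n)) atTop (𝓝 1) := by
    intro A C h
    have h' := (tendsto_evalOne_mul_evalOne_sub (D := 1) h).add_const 1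
    rw [zero_add] at h'
    refine h'.congr fun n => ?_
    have : evalOne ((1 : lp CuAlgebra ∞) n) = 1 :=
      ContractedAlgebra.one_apply_one (ω := Cu2.weight n)
    rw [this, sub_add_cancel]
  have zero_case : ∀ {A C : lp CuAlgebra ∞},
      Ideal.Quotient.mk (c0Ideal CuAlgebra) A * Ideal.Quotient.mk (c0Ideal CuAlgebra) C = 0 →
      Tendsto (fun n => evalOne (A n) * evalOne (C n)) atTop (𝓝 0) := by
    intro A C h
    refine (tendsto_evalOne_mul_evalOne_sub (D := 0) h).congr fun n => ?_
    have : evalOne ((0 : lp CuAlgebra ∞) n) = 0 := rfl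
    rw [this, sub_zero]
  have hl := (one_case h₁).mul (one_case h₂)
  have hr := (zero_case h₁₂).mul (zero_case h₂₁)
  have : (1 : ℂ) * 1 = 0 * 0 := by
    refine tendsto_nhds_unique hl (hr.congr fun n => ?_)
    ring
  norm_num at this

end CuAlgebra

theorem theorem4p14 :
    (∀ n : ℕ+, IsProperlyInfinite (CuAlgebra n)) ∧
    ¬ IsProperlyInfinite (Asy CuAlgebra) ∧
    ¬ (∀ (B : ℕ+ → Type) [∀ n, NormedRing (B n)] [∀ n, NormedAlgebra ℂ (B n)]
        [∀ n, NormOneClass (B n)] [∀ n, CompleteSpace (B n)],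
        (∃ N : ℕ+, ∀ n ≥ N, IsProperlyInfinite (B n)) → IsProperlyInfinite (Asy B)) :=
  ⟨CuAlgebra.isProperlyInfinite, CuAlgebra.not_isProperlyInfinite_asy, fun h =>
    CuAlgebra.not_isProperlyInfinite_asy
      (h CuAlgebra ⟨1, fun n _ => CuAlgebra.isProperlyInfinite n⟩)⟩
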